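/- Let $G=(U,W;E)$ be a finite bipartite graph, parallel edges allowed, and let $E(v)$ be the set of edges incident to an agent $v\in U\cup W$. Every agent $v$ has a valuation $p_v:E(v)\to\mathbb{R}_{\ge 0}$ and a value $p_v(\emptyset)\le 0$ for being unmatched; for every edge $e$ and endpoint $v$ of $e$ a threshold $\gamma_e^v>0$ is given. A matching is a set $M\subseteq E$ with $|M\cap E(v)|\le 1$ for all $v$; $M(v)$ is the edge of $M$ at $v$, or $\emptyset$ if there is none. A matching $M$ is *$\gamma$-min stable* if there is no edge $e\notin M$ with $p_v(e)\ge p_v(M(v))+\gamma_e^v$ for both endpoints $v$ of $e$, and *weakly stable* if there is no edge $e\notin M$ with $p_v(e)>p_v(M(v))$ for both endpoints $v$ of $e$. For matchings $M,N$ let $\mathrm{vote}^\gamma_v(M,N)$ be $0$ if $M(v)=N(v)$; $-1$ if $M(v)\ne N(v)\neq\emptyset$ and $p_v(N(v))\ge p_v(M(v))+\gamma_{N(v)}^v$; and $+1$ otherwise. Let $\mathrm{vote}^{weak}_v(M,N)$ be $0$ if $M(v)=N(v)$; $-1$ if $p_v(N(v))>p_v(M(v))$; and $+1$ otherwise. A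 matching $M$ is *$\gamma$-popular* (*weakly-popular*) if $\sum_{v\in U\cup W}\mathrm{vote}^\gamma_v(M,N)\ge 0$ (respectively $\sum_{v\in U\cup W}\mathrm{vote}^{weak}_v(M,N)\ge 0$) for every matching $N$. Consider the following algorithm. Replace every edge $e$ by six parallel copies $a(e),b(e),c(e),x(e),y(e),z(e)$. Give every agent a strict linear order on the copies of its incident edges such that agents in $U$ follow the rule $a\succeq^\gamma b\succ c\succ x\succeq^\gamma y\succ z$ and agents in $W$ follow the rule $z\succeq^\gamma y\succ x\succ c\succeq^\gamma b\succ a$. Here, for an agent $v$, $\alpha\succ\beta$ means that $\alpha(e)\succ_v\beta(f)$ for all $e,f\in E(v)$; $\alpha\succeq^\gamma\beta$ means that $\alpha(e)\succ_v\beta(e)$ for all $e\in E(v)$ and that, for all $e,f\in E(v)$, $\beta(f)\succ_v\alpha(e)$ if and only if $p_v(f)\ge p_v(e)+\gamma_f^v$; and within each of the types $a,c,x,z$ the copies are ordered by $p_v$. Everything else (ties, and the order within types $b$ and $y$) is arbitrary. Run the Gale–Shapley algorithm on the copies, with either side proposing, to get a matching $M'$, and output the set $M$ of the edges of $G$ that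 have a copy in $M'$. Such strict orders always exist, and for every choice of them and of the proposing side, $M'$ is a stable matching of the copies and the output $M$ satisfies the following. 1. $M$ is a $\gamma$-popular matching. If the thresholds are small enough, that is, if $p_v(e)>p_v(o)$ implies $p_v(e)\ge p_v(o)+\gamma_e^v$ for all $v$, all $e\in E(v)$ and all $o\in E(v)\cup\{\emptyset\}$, then $M$ is weakly-popular. 2. $|M|\ge\frac23|N|$ for every matching $N$. 3. $|M|\ge\frac34|N|$ for every $\gamma$-popular matching $N$, and in particular for every weakly-popular matching $N$. 4. $|M|\ge\frac45|N|$ for every $\gamma$-min stable matching $N$, and in particular for every weakly stable matching $N$. Consequently a $\gamma$-popular matching always exists, and so does a weakly-popular matching. -/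

import Mathlib

/-- A bipartite graph `(U, W; E)`, parallel edges allowed: `fst e` and `snd e` are the endpoints
of `e` in `U` and in `W`. -/
structure BipGraph (U W E : Type*) where
  fst : E → U
  snd : E → W

namespace BipGraph

variable {U W E : Type*}

/-- The endpoint of `e` in `U` (for `true`) or in `W` (for `false`), as an agent. -/
def endpt (G : BipGraph U W E) : Bool → E → U ⊕ W
  | true, e => Sum.inl (G.fst e)
  | false, e => Sum.inr (G.snd e)

/-- `G.Inc v e`: the edge `e` is incident to the agent `v`, that is, `e ∈ E(v)`. -/
def Inc (G : BipGraph U W E) (v : U ⊕ W) (e : E) : Prop :=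
  ∃ s, G.endpt s e = v

/-- A set of edges is a matching if every agent is incident to at most one of them. -/
def IsMatching (G : BipGraph U W E) (M : Finset E) : Prop :=
  ∀ v, ∀ e ∈ M, ∀ f ∈ M, G.Inc v e → G.Inc v f → e = f

open Classical in
/-- `M(v)`: the edge of `M` at `v`, or `none` if there is none. -/
noncomputable def at_ (G : BipGraph U W E) (M : Finset E) (v : U ⊕ W) : Option E :=
  if h : ∃ e ∈ M, G.Inc v e then some h.choose else none

/-! ### Strict preferences and the Gale–Shapley algorithm

`pref v e f` means that the agent `v` strictly prefers `e` to `f`; only edges incident to `v`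
matter, and being unmatched is worse than any of them. -/

/-- Every agent ranks the incident edges in a strict linear order. -/
structure IsStrictPref (G : BipGraph U W E) (pref : U ⊕ W → E → E → Prop) : Prop where
  irrefl : ∀ v e, G.Inc v e → ¬ pref v e e
  trans : ∀ v e f g, G.Inc v e → G.Inc v f → G.Inc v g → pref v e f → pref v f g → pref v e g
  total : ∀ v e f, G.Inc v e → G.Inc v f → e ≠ f → pref v e f ∨ pref v f e

/-- Stability for strict preferences: no edge outside `M` is preferred by both of its endpoints
to what they have in `M`. -/
def IsStable (G : BipGraph U W E) (pref : U ⊕ W → E → E → Prop) (M : Finset E) : Prop :=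
  G.IsMatching M ∧
    ¬ ∃ e, e ∉ M ∧ ∀ v, G.Inc v e → ∀ f ∈ M, G.Inc v f → pref v e f

section GaleShapley

variable [Fintype E]

open Classical in
/-- The proposals of a round in which the edges of `R` have already been rejected: every agent of
the proposing side `s` proposes its best edge that has not been rejected, if there is one. -/
noncomputable def proposals (G : BipGraph U W E) (pref : U ⊕ W → E → E → Prop) (s : Bool)
    (R : Finset E) : Finset E :=
  Finset.univ.filter fun e =>
    e ∉ R ∧ ∀ f, f ∉ R → G.endpt s f = G.endpt s e → f ≠ e → pref (G.endpt s e) e f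

open Classical in
/-- The proposals that are tentatively held: every agent of the receiving side holds the best
proposal it has got. -/
noncomputable def held (G : BipGraph U W E) (pref : U ⊕ W → E → E → Prop) (s : Bool)
    (R : Finset E) : Finset E :=
  (G.proposals pref s R).filter fun e =>
    ∀ f ∈ G.proposals pref s R,
      G.endpt (!s) f = G.endpt (!s) e → f ≠ e → pref (G.endpt (!s) e) e f

open Classical in
/-- One round of deferred acceptance: the proposals that are not held become rejected. -/
noncomputable def round (G : BipGraph U W E) (pref : U ⊕ W → E → E → Prop) (s : Bool)
    (R : Finset E) : Finset E :=
  R ∪ (G.proposals pref s R \ G.held pref s R)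

/-- The Gale–Shapley algorithm with proposing side `s`. Every round but the last rejects an edge,
so after `|E|` rounds nothing changes any more; the proposals then held are the output. -/
noncomputable def galeShapley (G : BipGraph U W E) (pref : U ⊕ W → E → E → Prop) (s : Bool) :
    Finset E :=
  G.held pref s ((G.round pref s)^[Fintype.card E] ∅)

end GaleShapley

end BipGraph

/-- A matching market: a bipartite graph with preference valuations. `p v (some e)` is `p_v(e)`
(it matters only for edges `e` incident to `v`) and `p v none` is `p_v(∅)`. -/
structure Market (U W E : Type*) extends BipGraph U W E where
  p : U ⊕ W → Option E → ℝ
  p_nonneg : ∀ v e, toBipGraph.Inc v e → 0 ≤ p v (some e)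
  p_none_nonpos : ∀ v, p v none ≤ 0

/-- The six types of copies of an edge. -/
inductive Copy
  | a | b | c | x | y | z
  deriving DecidableEq

instance : Fintype Copy where
  elems := {Copy.a, Copy.b, Copy.c, Copy.x, Copy.y, Copy.z}
  complete k := by cases k <;> simp

namespace Market

variable {U W E : Type*}

/-! ### Stability -/

/-- Weak stability. -/
def IsWeaklyStable (I : Market U W E) (M : Finset E) : Prop :=
  I.IsMatching M ∧
    ¬ ∃ e, e ∉ M ∧ ∀ v, I.Inc v e → I.p v (I.at_ M v) < I.p v (some e)

/-- `γ`-min stability; `γ v e` is `γ_e^v`. -/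
def IsGammaMinStable (I : Market U W E) (γ : U ⊕ W → E → ℝ) (M : Finset E) : Prop :=
  I.IsMatching M ∧
    ¬ ∃ e, e ∉ M ∧ ∀ v, I.Inc v e → I.p v (I.at_ M v) + γ v e ≤ I.p v (some e)

/-! ### Popularity -/

open Classical in
/-- The vote of `v` between `M` and `N` in weak popularity. -/
noncomputable def voteWeak (I : Market U W E) (M N : Finset E) (v : U ⊕ W) : ℤ :=
  if I.at_ M v = I.at_ N v then 0
  else if I.p v (I.at_ M v) < I.p v (I.at_ N v) then -1
  else 1

open Classical in
/-- The vote of `v` between `M` and `N` in `γ`-popularity. An agent that is matched in `M` but not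
in `N` votes for `M`. -/
noncomputable def voteGamma (I : Market U W E) (γ : U ⊕ W → E → ℝ) (M N : Finset E)
    (v : U ⊕ W) : ℤ :=
  if I.at_ M v = I.at_ N v then 0
  else match I.at_ N v with
    | none => 1
    | some e => if I.p v (I.at_ M v) + γ v e ≤ I.p v (some e) then -1 else 1

/-- Weak popularity. -/
def IsWeaklyPopular [Fintype U] [Fintype W] (I : Market U W E) (M : Finset E) : Prop :=
  I.IsMatching M ∧ ∀ N, I.IsMatching N → 0 ≤ ∑ v, I.voteWeak M N v

/-- `γ`-popularity. -/
def IsGammaPopular [Fintype U] [Fintype W] (I : Market U W E) (γ : U ⊕ W → E → ℝ)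
    (M : Finset E) : Prop :=
  I.IsMatching M ∧ ∀ N, I.IsMatching N → 0 ≤ ∑ v, I.voteGamma γ M N v

/-- The thresholds are so small that every strict improvement of an agent reaches them. -/
def IsSmall (I : Market U W E) (γ : U ⊕ W → E → ℝ) : Prop :=
  ∀ v e, I.Inc v e → ∀ o : Option E, (∀ f, o = some f → I.Inc v f) →
    I.p v o < I.p v (some e) → I.p v o + γ v e ≤ I.p v (some e)

/-! ### The algorithm -/

/-- The graph with six parallel copies of every edge. -/
def copies (I : Market U W E) : BipGraph U W (Copy × E) where
  fst d := I.fst d.2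
  snd d := I.snd d.2

/-- `α ≻ β` at `v`. -/
def Above (I : Market U W E) (pref : U ⊕ W → Copy × E → Copy × E → Prop) (v : U ⊕ W)
    (α β : Copy) : Prop :=
  ∀ e f, I.Inc v e → I.Inc v f → pref v (α, e) (β, f)

/-- `α ⪰^γ β` at `v`. -/
def GammaAbove (I : Market U W E) (γ : U ⊕ W → E → ℝ)
    (pref : U ⊕ W → Copy × E → Copy × E → Prop) (v : U ⊕ W) (α β : Copy) : Prop :=
  (∀ e, I.Inc v e → pref v (α, e) (β, e)) ∧
    ∀ e f, I.Inc v e → I.Inc v f →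
      (pref v (β, f) (α, e) ↔ I.p v (some e) + γ v f ≤ I.p v (some f))

/-- At `v` the copies of type `α` are ranked according to `p_v`, with ties broken arbitrarily. -/
def Sorted (I : Market U W E) (pref : U ⊕ W → Copy × E → Copy × E → Prop) (v : U ⊕ W)
    (α : Copy) : Prop :=
  ∀ e f, I.Inc v e → I.Inc v f → I.p v (some f) < I.p v (some e) → pref v (α, e) (α, f)

/-- The ranking of `v` follows the rule `α₁ ⪰^γ β₁ ≻ δ₁ ≻ α₂ ⪰^γ β₂ ≻ δ₂`. -/
def FollowsRule (I : Market U W E) (γ : U ⊕ W → E → ℝ)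
    (pref : U ⊕ W → Copy × E → Copy × E → Prop) (v : U ⊕ W) (α₁ β₁ δ₁ α₂ β₂ δ₂ : Copy) : Prop :=
  I.GammaAbove γ pref v α₁ β₁ ∧ I.Above pref v β₁ δ₁ ∧ I.Above pref v δ₁ α₂ ∧
    I.GammaAbove γ pref v α₂ β₂ ∧ I.Above pref v β₂ δ₂ ∧
    I.Sorted pref v α₁ ∧ I.Sorted pref v δ₁ ∧ I.Sorted pref v α₂ ∧ I.Sorted pref v δ₂

/-- `pref` is one of the strict preference systems on the copies that the algorithm may create;
everything the rules leave open is arbitrary. -/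
structure IsInduced (I : Market U W E) (γ : U ⊕ W → E → ℝ)
    (pref : U ⊕ W → Copy × E → Copy × E → Prop) : Prop where
  strict : I.copies.IsStrictPref pref
  left : ∀ u : U, I.FollowsRule γ pref (Sum.inl u) Copy.a Copy.b Copy.c Copy.x Copy.y Copy.z
  right : ∀ w : W, I.FollowsRule γ pref (Sum.inr w) Copy.z Copy.y Copy.x Copy.c Copy.b Copy.a

open Classical in
/-- The output of the algorithm: the edges with a copy in the Gale–Shapley matching. -/
noncomputable def output [Fintype E] (I : Market U W E)
    (pref : U ⊕ W → Copy × E → Copy × E → Prop) (s : Bool) : Finset E :=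
  (I.copies.galeShapley pref s).image Prod.snd

end Market

/-!
The order in which one side ranks the six types is the reverse of the order of the other side, so
every edge of the output `M` has exactly one endpoint that sees its copy among its three better
types; let `P` be the set of these endpoints. Giving the agents in `P` the dual value `1`, their
partners `-1` and unmatched agents `0`, stability of the copies shows that on every edge the votes
and the dual values have a nonnegative sum; since the dual values add up to `0`, the matching `M` is
popular.

An edge at an agent that `M` leaves unmatched forces its other endpoint to hold a copy of type `a`
or `b` (as that endpoint sees it). This excludes augmenting paths with three edges, which gives
`2/3`. If moreover an edge of `N` joins the partner of such an endpoint to an agent outside `P`,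
then stability makes both endpoints of the edge of `M` between them prefer it to their edges of `N`
by the threshold. So it blocks a min stable `N`; and on an augmenting path with five edges this
happens to both edges of `M`, so that an exchange along the path refutes the popularity of `N`.
These exclusions give `4/5` and `3/4`: the unit weight of every edge of `M` can be split between its
endpoints so that every edge of `N` receives enough.
-/

theorem isFixedPt_iterate_card {α : Type*} [Fintype α] {f : Finset α → Finset α}
    (hf : ∀ R, R ⊆ f R) (R : Finset α) : Function.IsFixedPt f (f^[Fintype.card α] R) := by
  have grows (n : ℕ) : n ≤ (f^[n] R).card ∨ Function.IsFixedPt f (f^[n] R) := by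
    induction n with
    | zero => exact Or.inl (Nat.zero_le _)
    | succ n ih =>
      rw [Function.iterate_succ_apply']
      by_cases hfix : Function.IsFixedPt f (f^[n] R)
      · exact Or.inr (hfix.symm ▸ hfix)
      · exact Or.inl ((ih.resolve_right hfix).trans_lt
          (Finset.card_lt_card ((hf _).ssubset_of_ne (Ne.symm hfix))))
  refine (grows _).elim (fun hcard => ?_) id
  have huniv := Finset.eq_univ_of_card _ (le_antisymm (Finset.card_le_univ _) hcard)
  exact huniv ▸ Finset.univ_subset_iff.1 (hf _)

namespace BipGraph

variable {U W E : Type*} {G : BipGraph U W E} {M N : Finset E} {v w x : U ⊕ W} {e f : E}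
  {s t : Bool}

/-! ### Edges and matchings -/

theorem inc_endpt : G.Inc (G.endpt s e) e := ⟨s, rfl⟩

theorem side_eq_of_endpt_eq (h : G.endpt s e = G.endpt t f) : s = t := by
  cases s <;> cases t <;> simp_all [endpt]

theorem endpt_eq_of_inc (h : G.Inc (G.endpt s e) f) : G.endpt s f = G.endpt s e := by
  obtain ⟨t, ht⟩ := h
  obtain rfl := side_eq_of_endpt_eq ht
  exact ht

/-- The edge `e` has the two endpoints `v` and `w`, in either order. -/
def Joins (G : BipGraph U W E) (e : E) (v w : U ⊕ W) : Prop :=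
  ∃ s, G.endpt s e = v ∧ G.endpt (!s) e = w

theorem joins_endpt : G.Joins e (G.endpt s e) (G.endpt (!s) e) := ⟨s, rfl, rfl⟩

theorem Inc.exists_joins (h : G.Inc v e) : ∃ w, G.Joins e v w := by
  obtain ⟨s, rfl⟩ := h
  exact ⟨_, joins_endpt⟩

namespace Joins

theorem symm (h : G.Joins e v w) : G.Joins e w v := by
  obtain ⟨s, hv, hw⟩ := h
  exact ⟨!s, hw, by rwa [Bool.not_not]⟩

theorem inc_left (h : G.Joins e v w) : G.Inc v e := h.imp fun _ => And.left

theorem inc_right (h : G.Joins e v w) : G.Inc w e := h.symm.inc_left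

theorem ne (h : G.Joins e v w) : v ≠ w := by
  obtain ⟨s, rfl, rfl⟩ := h
  exact fun heq => (Bool.eq_not_self s).1 (side_eq_of_endpt_eq heq)

theorem inc_iff (h : G.Joins e v w) : G.Inc x e ↔ x = v ∨ x = w := by
  refine ⟨?_, by rintro (rfl | rfl) <;> [exact h.inc_left; exact h.inc_right]⟩
  obtain ⟨s, rfl, rfl⟩ := h
  rintro ⟨t, rfl⟩
  rcases Bool.eq_or_eq_not t s with rfl | rfl <;> simp

theorem right_unique (h : G.Joins e v w) (h' : G.Joins e v x) : w = x :=
  (h'.inc_iff.1 h.inc_right).resolve_left h.ne.symm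

theorem sum_endpt {A : Type*} [AddCommMonoid A] (h : G.Joins e v w) (F : U ⊕ W → A) :
    ∑ s, F (G.endpt s e) = F v + F w := by
  obtain ⟨s, rfl, rfl⟩ := h
  cases s <;> simp [add_comm]

end Joins

open Classical in
/-- The agents that are matched by `M`. -/
noncomputable def covered (G : BipGraph U W E) (M : Finset E) : Finset (U ⊕ W) :=
  (M ×ˢ Finset.univ).image fun q : E × Bool => G.endpt q.2 q.1

theorem mem_covered : v ∈ G.covered M ↔ ∃ e ∈ M, G.Inc v e := by
  simp [covered, Inc]

theorem mem_of_at_eq_some (h : G.at_ M v = some e) : e ∈ M ∧ G.Inc v e := by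
  unfold at_ at h
  split_ifs at h with h'
  cases h
  exact h'.choose_spec

theorem at_eq_none_iff : G.at_ M v = none ↔ v ∉ G.covered M := by
  rw [mem_covered, at_]
  split_ifs with h <;> simp [h]

namespace IsMatching

theorem eq_of_endpt_eq (hM : G.IsMatching M) (he : e ∈ M) (hf : f ∈ M)
    (h : G.endpt s e = G.endpt s f) : e = f :=
  hM _ e he f hf inc_endpt ⟨s, h.symm⟩

theorem at_eq_some (hM : G.IsMatching M) (he : e ∈ M) (hv : G.Inc v e) : G.at_ M v = some e := by
  cases h : G.at_ M v with
  | none => exact absurd (mem_covered.2 ⟨e, he, hv⟩) (at_eq_none_iff.1 h)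
  | some f =>
    obtain ⟨hf, hvf⟩ := mem_of_at_eq_some h
    rw [hM v f hf e he hvf hv]

theorem sum_covered {A : Type*} [AddCommMonoid A] (hM : G.IsMatching M) (F : U ⊕ W → A) :
    ∑ v ∈ G.covered M, F v = ∑ e ∈ M, ∑ s, F (G.endpt s e) := by
  classical
  rw [covered, Finset.sum_image, Finset.sum_product]
  rintro ⟨e, s⟩ he ⟨f, t⟩ hf h
  obtain rfl : s = t := side_eq_of_endpt_eq h
  obtain rfl : e = f :=
    hM.eq_of_endpt_eq (Finset.mem_product.1 he).1 (Finset.mem_product.1 hf).1 h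
  rfl

theorem sum_covered_eq_card_nsmul {A : Type*} [AddCommMonoid A] (hM : G.IsMatching M)
    {F : U ⊕ W → A} {a : A} (h : ∀ e ∈ M, ∀ v w, G.Joins e v w → F v + F w = a) :
    ∑ v ∈ G.covered M, F v = M.card • a := by
  rw [hM.sum_covered]
  exact Finset.sum_eq_card_nsmul fun e he =>
    (joins_endpt.sum_endpt F).trans (h e he _ _ (joins_endpt (s := true)))

end IsMatching

/-! ### The Gale–Shapley algorithm -/

section GaleShapley

variable {pref : U ⊕ W → E → E → Prop}

namespace IsStrictPref

theorem asymm (h : G.IsStrictPref pref) (he : G.Inc v e) (hf : G.Inc v f) (hef : pref v e f) :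
    ¬ pref v f e :=
  fun hfe => h.irrefl v e he (h.trans v e f e he hf he hef hfe)

theorem of_injective {A : Type*} [LinearOrder A] {key : U ⊕ W → E → A}
    (h : ∀ v, Function.Injective (key v)) : G.IsStrictPref fun v e f => key v e < key v f where
  irrefl _ _ _ := lt_irrefl _
  trans _ _ _ _ _ _ _ := lt_trans
  total v _ _ _ _ hne := lt_or_gt_of_ne ((h v).ne hne)

theorem exists_best (h : G.IsStrictPref pref) {A : Finset E} (hA : A.Nonempty)
    (hinc : ∀ e ∈ A, G.Inc v e) : ∃ e ∈ A, ∀ f ∈ A, f ≠ e → pref v e f := by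
  let better (d d' : A) : Prop := pref v d d'
  have : Std.Irrefl better := ⟨fun d => h.irrefl v d (hinc d d.2)⟩
  have : IsTrans A better :=
    ⟨fun d d' d'' => h.trans v d d' d'' (hinc d d.2) (hinc d' d'.2) (hinc d'' d''.2)⟩
  obtain ⟨e, -, hbest⟩ := (Finite.wellFounded_of_trans_of_irrefl better).has_min Set.univ
    (Set.nonempty_iff_univ_nonempty.1 hA.to_subtype)
  exact ⟨e, e.2, fun f hf hfe => (h.total v e f (hinc e e.2) (hinc f hf) hfe.symm).resolve_right
    (hbest ⟨f, hf⟩ (Set.mem_univ _))⟩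

end IsStrictPref

variable [Fintype E] {R : Finset E}

theorem mem_proposals : e ∈ G.proposals pref s R ↔
    e ∉ R ∧ ∀ f, f ∉ R → G.endpt s f = G.endpt s e → f ≠ e → pref (G.endpt s e) e f := by
  simp [proposals]

theorem mem_held : e ∈ G.held pref s R ↔ e ∈ G.proposals pref s R ∧
    ∀ f ∈ G.proposals pref s R,
      G.endpt (!s) f = G.endpt (!s) e → f ≠ e → pref (G.endpt (!s) e) e f := by
  simp [held]

theorem mem_round : e ∈ G.round pref s R ↔
    e ∈ R ∨ (e ∈ G.proposals pref s R ∧ e ∉ G.held pref s R) := by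
  simp [round]

theorem subset_round : R ⊆ G.round pref s R := fun _ h => mem_round.2 (Or.inl h)

theorem held_subset_proposals_round :
    G.held pref s R ⊆ G.proposals pref s (G.round pref s R) := by
  intro e he
  obtain ⟨heR, hbest⟩ := mem_proposals.1 (mem_held.1 he).1
  refine mem_proposals.2 ⟨fun h => ?_, fun f hf => hbest f fun h => hf (subset_round h)⟩
  exact (mem_round.1 h).elim heR fun hrej => hrej.2 he

theorem proposals_subset_held (hR : Function.IsFixedPt (G.round pref s) R) :
    G.proposals pref s R ⊆ G.held pref s R := by
  intro e he
  by_contra hne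
  have hround : e ∈ G.round pref s R := mem_round.2 (Or.inr ⟨he, hne⟩)
  exact (mem_proposals.1 he).1 (hR.eq ▸ hround)

/-- Every rejected edge is beaten by a current proposal at its receiving agent: the invariant of
deferred acceptance. -/
def RejectedBeaten (G : BipGraph U W E) (pref : U ⊕ W → E → E → Prop) (s : Bool)
    (R : Finset E) : Prop :=
  ∀ r ∈ R, ∃ d ∈ G.proposals pref s R, G.endpt (!s) d = G.endpt (!s) r ∧
    pref (G.endpt (!s) r) d r

namespace IsStrictPref

theorem exists_proposal (h : G.IsStrictPref pref) (he : e ∉ R) :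
    ∃ d ∈ G.proposals pref s R, G.endpt s d = G.endpt s e ∧
      (d ≠ e → pref (G.endpt s e) d e) := by
  classical
  obtain ⟨d, hd, hbest⟩ := h.exists_best (v := G.endpt s e)
    (A := Finset.univ.filter fun f => f ∉ R ∧ G.endpt s f = G.endpt s e) ⟨e, by simpa using he⟩
    (fun f hf => ⟨s, (Finset.mem_filter.1 hf).2.2⟩)
  obtain ⟨-, hdR, hde⟩ := Finset.mem_filter.1 hd
  refine ⟨d, mem_proposals.2 ⟨hdR, fun f hf hfd hne => ?_⟩, hde,
    fun hne => hbest e (by simpa using he) hne.symm⟩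
  rw [hde]
  exact hbest f (by simpa using ⟨hf, hfd.trans hde⟩) hne

theorem exists_held (h : G.IsStrictPref pref) (he : e ∈ G.proposals pref s R) :
    ∃ d ∈ G.held pref s R, G.endpt (!s) d = G.endpt (!s) e ∧
      (d ≠ e → pref (G.endpt (!s) e) d e) := by
  classical
  obtain ⟨d, hd, hbest⟩ := h.exists_best (v := G.endpt (!s) e)
    (A := (G.proposals pref s R).filter fun f => G.endpt (!s) f = G.endpt (!s) e)
    ⟨e, by simpa using he⟩ (fun f hf => ⟨!s, (Finset.mem_filter.1 hf).2⟩)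
  obtain ⟨hdp, hde⟩ := Finset.mem_filter.1 hd
  refine ⟨d, mem_held.2 ⟨hdp, fun f hf hfd hne => ?_⟩, hde,
    fun hne => hbest e (by simpa using he) hne.symm⟩
  rw [hde]
  exact hbest f (Finset.mem_filter.2 ⟨hf, hfd.trans hde⟩) hne

theorem rejectedBeaten_round (h : G.IsStrictPref pref) (hR : G.RejectedBeaten pref s R) :
    G.RejectedBeaten pref s (G.round pref s R) := by
  intro r hr
  rcases mem_round.1 hr with hr | ⟨hr, hr'⟩
  · obtain ⟨d, hd, hdr, hp⟩ := hR r hr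
    obtain ⟨g, hg, hgd, hgp⟩ := h.exists_held hd
    refine ⟨g, held_subset_proposals_round hg, hgd.trans hdr, ?_⟩
    by_cases hne : g = d
    · exact hne ▸ hp
    · rw [hdr] at hgp hgd
      exact h.trans _ g d r ⟨!s, hgd⟩ ⟨!s, hdr⟩ inc_endpt (hgp hne) hp
  · obtain ⟨g, hg, hgr, hgp⟩ := h.exists_held hr
    exact ⟨g, held_subset_proposals_round hg, hgr, hgp (by rintro rfl; exact hr' hg)⟩

theorem rejectedBeaten_iterate (h : G.IsStrictPref pref) (n : ℕ) :
    G.RejectedBeaten pref s ((G.round pref s)^[n] ∅) :=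
  Function.Iterate.rec (G.RejectedBeaten pref s) (by simp [RejectedBeaten])
    (fun _ => h.rejectedBeaten_round) n

theorem isMatching_held (h : G.IsStrictPref pref) : G.IsMatching (G.held pref s R) := by
  have best {t : Bool} {e f : E} (he : e ∈ G.held pref s R) (hf : f ∈ G.held pref s R)
      (hfe : G.endpt t f = G.endpt t e) (hne : f ≠ e) : pref (G.endpt t e) e f := by
    obtain ⟨hep, hebest⟩ := mem_held.1 he
    have hfp := (mem_held.1 hf).1
    rcases Bool.eq_or_eq_not t s with rfl | rfl
    · exact (mem_proposals.1 hep).2 f (mem_proposals.1 hfp).1 hfe hne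
    · exact hebest f hfp hfe hne
  rintro _ e he f hf ⟨t, rfl⟩ hvf
  have hfe := endpt_eq_of_inc hvf
  by_contra hne
  exact h.asymm inc_endpt hvf (best he hf hfe (Ne.symm hne)) (hfe ▸ best hf he hfe.symm hne)

theorem isStable_held (h : G.IsStrictPref pref) (hfix : Function.IsFixedPt (G.round pref s) R)
    (hR : G.RejectedBeaten pref s R) : G.IsStable pref (G.held pref s R) := by
  refine ⟨h.isMatching_held, ?_⟩
  rintro ⟨e, he, hblock⟩
  suffices hbeaten : ∃ t, ∃ d ∈ G.proposals pref s R, G.endpt t d = G.endpt t e ∧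
      pref (G.endpt t e) d e by
    obtain ⟨t, d, hd, hde, hp⟩ := hbeaten
    exact h.asymm ⟨t, hde⟩ inc_endpt hp
      (hblock _ inc_endpt d (proposals_subset_held hfix hd) ⟨t, hde⟩)
  by_cases heR : e ∈ R
  · exact ⟨!s, hR e heR⟩
  · obtain ⟨d, hd, hde, hp⟩ := h.exists_proposal heR
    exact ⟨s, d, hd, hde, hp (by rintro rfl; exact he (proposals_subset_held hfix hd))⟩

theorem isStable_galeShapley (h : G.IsStrictPref pref) (s : Bool) :
    G.IsStable pref (G.galeShapley pref s) :=
  h.isStable_held (isFixedPt_iterate_card (fun _ => subset_round) ∅) (h.rejectedBeaten_iterate _)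

end IsStrictPref

end GaleShapley

/-! ### Comparing the sizes of two matchings -/

/-- `P` consists of one endpoint of every edge of `M`. -/
structure IsTransversal (G : BipGraph U W E) (M : Finset E) (P : Set (U ⊕ W)) : Prop where
  subset_covered : P ⊆ G.covered M
  mem_iff_notMem : ∀ ⦃e⦄, e ∈ M → ∀ ⦃v w⦄, G.Joins e v w → (v ∈ P ↔ w ∉ P)

/-- An edge of `N` leads from `v` to an agent that `M` leaves unmatched. -/
def NextToExposed (G : BipGraph U W E) (M N : Finset E) (v : U ⊕ W) : Prop :=
  ∃ e ∈ N, ∃ u ∉ G.covered M, G.Joins e v u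

/-- The partner of `v` in `M` is joined by an edge of `N` to an agent that `M` leaves unmatched. -/
def MateNextToExposed (G : BipGraph U W E) (M N : Finset E) (v : U ⊕ W) : Prop :=
  ∃ f ∈ M, ∃ w, G.Joins f v w ∧ G.NextToExposed M N w

open Classical in
/-- A weighting of the agents with total `|M|` for a transversal `P` of `M`: every edge of `M`
splits its unit of weight into `r` and `1 - r` if an endpoint is next to an exposed agent, and into
`m` and `1 - m` otherwise, the endpoint in `P` getting the first share. -/
noncomputable def weight (G : BipGraph U W E) (M N : Finset E) (P : Set (U ⊕ W)) (r m : ℝ)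
    (v : U ⊕ W) : ℝ :=
  if v ∉ G.covered M then 0
  else if G.NextToExposed M N v then r
  else if G.MateNextToExposed M N v then 1 - r
  else if v ∈ P then m
  else 1 - m

namespace IsTransversal

variable {P : Set (U ⊕ W)} {r m : ℝ}

theorem notMem_of_mateNextToExposed (hP : G.IsTransversal M P)
    (hexp : ∀ v, G.NextToExposed M N v → v ∈ P) (h : G.MateNextToExposed M N v) : v ∉ P := by
  obtain ⟨f, hf, w, hfj, hw⟩ := h
  exact (hP.mem_iff_notMem hf hfj.symm).1 (hexp w hw)

theorem weight_add_weight (hP : G.IsTransversal M P) (hM : G.IsMatching M)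
    (hexp : ∀ v, G.NextToExposed M N v → v ∈ P) (hf : f ∈ M) (hfj : G.Joins f v w) :
    G.weight M N P r m v + G.weight M N P r m w = 1 := by
  wlog hv : v ∈ P generalizing v w
  · rw [add_comm]
    exact this hfj.symm (not_not.1 (mt (hP.mem_iff_notMem hf hfj).2 hv))
  have hw : w ∉ P := (hP.mem_iff_notMem hf hfj).1 hv
  have mate_iff : G.MateNextToExposed M N w ↔ G.NextToExposed M N v := by
    refine ⟨?_, fun h => ⟨f, hf, v, hfj.symm, h⟩⟩
    rintro ⟨g, hg, v', hgj, h⟩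
    obtain rfl := hM w g hg f hf hgj.inc_left hfj.inc_right
    rwa [hfj.symm.right_unique hgj]
  have hvmate : ¬ G.MateNextToExposed M N v :=
    fun h => hP.notMem_of_mateNextToExposed hexp h hv
  have hwnext : ¬ G.NextToExposed M N w := fun h => hw (hexp w h)
  have hvM : v ∈ G.covered M := mem_covered.2 ⟨f, hf, hfj.inc_left⟩
  have hwM : w ∈ G.covered M := mem_covered.2 ⟨f, hf, hfj.inc_right⟩
  by_cases h : G.NextToExposed M N v <;>
    simp [weight, hvM, hwM, hwnext, hvmate, mate_iff, h, hv, hw]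

theorem le_weight_add_weight_of_notMem_covered (hP : G.IsTransversal M P)
    (hexp : ∀ v, G.NextToExposed M N v → v ∈ P) (he : e ∈ N) (hej : G.Joins e v w)
    (hv : v ∉ G.covered M) : r ≤ G.weight M N P r m v + G.weight M N P r m w := by
  have hw : G.NextToExposed M N w := ⟨e, he, v, hv, hej.symm⟩
  simp [weight, hv, hw, Finset.mem_coe.1 (hP.subset_covered (hexp w hw))]

theorem mul_card_le (hP : G.IsTransversal M P) (hM : G.IsMatching M) (hN : G.IsMatching N)
    (hexp : ∀ v, G.NextToExposed M N v → v ∈ P)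
    (hr : r ∈ Set.Icc 0 1) (hm : m ∈ Set.Icc 0 1)
    (hedge : ∀ e ∈ N, e ∉ M → ∀ v ∈ G.covered M, ∀ w ∈ G.covered M, G.Joins e v w →
      r ≤ G.weight M N P r m v + G.weight M N P r m w) :
    r * N.card ≤ M.card := by
  classical
  have le_edge (e : E) (he : e ∈ N) : r ≤ ∑ s, G.weight M N P r m (G.endpt s e) := by
    have hej : G.Joins e (G.endpt true e) (G.endpt false e) := joins_endpt
    rw [hej.sum_endpt]
    by_cases hv : G.endpt true e ∈ G.covered M
    · by_cases hw : G.endpt false e ∈ G.covered M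
      · by_cases heM : e ∈ M
        · exact (hP.weight_add_weight hM hexp heM hej).symm ▸ hr.2
        · exact hedge e he heM _ hv _ hw hej
      · rw [add_comm]
        exact hP.le_weight_add_weight_of_notMem_covered hexp he hej.symm hw
    · exact hP.le_weight_add_weight_of_notMem_covered hexp he hej hv
  have weight_nonneg (v : U ⊕ W) : 0 ≤ G.weight M N P r m v := by
    unfold weight
    split_ifs <;> linarith [hr.1, hr.2, hm.1, hm.2]
  have weight_eq_zero (v : U ⊕ W) (hv : v ∉ G.covered M) : G.weight M N P r m v = 0 := by
    simp [weight, hv]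
  calc r * N.card = ∑ _ ∈ N, r := by rw [Finset.sum_const, nsmul_eq_mul, mul_comm]
    _ ≤ ∑ e ∈ N, ∑ s, G.weight M N P r m (G.endpt s e) := Finset.sum_le_sum le_edge
    _ = ∑ v ∈ G.covered N, G.weight M N P r m v := (hN.sum_covered _).symm
    _ ≤ ∑ v ∈ G.covered M ∪ G.covered N, G.weight M N P r m v :=
      Finset.sum_le_sum_of_subset_of_nonneg Finset.subset_union_right fun v _ _ => weight_nonneg v
    _ = ∑ v ∈ G.covered M, G.weight M N P r m v :=
      (Finset.sum_subset Finset.subset_union_left fun v _ hv => weight_eq_zero v hv).symm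
    _ = M.card := by
      rw [hM.sum_covered_eq_card_nsmul fun f hf v w => hP.weight_add_weight hM hexp hf,
        nsmul_one]

theorem two_thirds_mul_card_le (hP : G.IsTransversal M P) (hM : G.IsMatching M)
    (hN : G.IsMatching N) (hexp : ∀ v, G.NextToExposed M N v → v ∈ P) :
    (2 / 3 : ℝ) * N.card ≤ M.card := by
  refine hP.mul_card_le (m := 1 / 2) hM hN hexp (by norm_num) (by norm_num) ?_
  intro e _ _ v hv w hw _
  have third_le {x : U ⊕ W} (hx : x ∈ G.covered M) :
      1 / 3 ≤ G.weight M N P (2 / 3) (1 / 2) x := by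
    rw [weight, if_neg (not_not.2 hx)]
    split_ifs <;> norm_num
  linarith [third_le hv, third_le hw]

/-- The hypothesis `hmate` excludes the augmenting paths with five edges. -/
theorem three_quarters_mul_card_le (hP : G.IsTransversal M P) (hM : G.IsMatching M)
    (hN : G.IsMatching N) (hexp : ∀ v, G.NextToExposed M N v → v ∈ P)
    (hmate : ∀ e ∈ N, e ∉ M → ∀ v w, G.Joins e v w →
      G.MateNextToExposed M N v → ¬ G.MateNextToExposed M N w) :
    (3 / 4 : ℝ) * N.card ≤ M.card := by
  refine hP.mul_card_le (m := 1 / 2) hM hN hexp (by norm_num) (by norm_num) ?_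
  intro e he heM v hv w hw hej
  have hnot := hmate e he heM v w hej
  simp only [weight, hv, hw, not_true_eq_false, if_false]
  split_ifs <;> first | exact absurd ‹_› (hnot ‹_›) | norm_num

theorem four_fifths_mul_card_le (hP : G.IsTransversal M P) (hM : G.IsMatching M)
    (hN : G.IsMatching N) (hexp : ∀ v, G.NextToExposed M N v → v ∈ P)
    (hmate : ∀ e ∈ N, e ∉ M → ∀ v w, G.Joins e v w → G.MateNextToExposed M N v → w ∈ P) :
    (4 / 5 : ℝ) * N.card ≤ M.card := by
  refine hP.mul_card_le (m := 3 / 5) hM hN hexp (by norm_num) (by norm_num) ?_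
  intro e he heM v hv w hw hej
  have compensates {x y : U ⊕ W} (hxy : G.Joins e x y) (hy : y ∈ G.covered M)
      (hx : G.MateNextToExposed M N x) : 3 / 5 ≤ G.weight M N P (4 / 5) (3 / 5) y := by
    have hyP := hmate e he heM x y hxy hx
    have hymate : ¬ G.MateNextToExposed M N y :=
      fun h => hP.notMem_of_mateNextToExposed hexp h hyP
    simp only [weight, hy, hyP, hymate, not_true_eq_false, if_false, if_true]
    split_ifs <;> norm_num
  have two_fifths_le {x : U ⊕ W} (hx : x ∈ G.covered M) (hxmate : ¬ G.MateNextToExposed M N x) :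
      2 / 5 ≤ G.weight M N P (4 / 5) (3 / 5) x := by
    simp only [weight, hx, hxmate, not_true_eq_false, if_false]
    split_ifs <;> norm_num
  have fifth_le {x : U ⊕ W} (hx : x ∈ G.covered M) :
      1 / 5 ≤ G.weight M N P (4 / 5) (3 / 5) x := by
    rw [weight, if_neg (not_not.2 hx)]
    split_ifs <;> norm_num
  by_cases hvmate : G.MateNextToExposed M N v
  · linarith [fifth_le hv, compensates hej hw hvmate]
  by_cases hwmate : G.MateNextToExposed M N w
  · linarith [compensates hej.symm hv hwmate, fifth_le hw]
  · linarith [two_fifths_le hv hvmate, two_fifths_le hw hwmate]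

end IsTransversal

/-! ### Switching to a small matching -/

open Classical in
/-- The edges of `F` together with those of `N` that do not meet them. -/
noncomputable def switch (G : BipGraph U W E) (N F : Finset E) : Finset E :=
  N.filter (fun d => ∀ v ∈ G.covered F, ¬ G.Inc v d) ∪ F

section Switch

variable {F : Finset E}

theorem mem_switch :
    e ∈ G.switch N F ↔ (e ∈ N ∧ ∀ v ∈ G.covered F, ¬ G.Inc v e) ∨ e ∈ F := by
  simp [switch]

namespace IsMatching

theorem mono (hM : G.IsMatching M) (h : F ⊆ M) : G.IsMatching F :=
  fun v e he f hf => hM v e (h he) f (h hf)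

theorem switch (hN : G.IsMatching N) (hF : G.IsMatching F) : G.IsMatching (G.switch N F) := by
  intro v d hd d' hd' hv hv'
  rcases mem_switch.1 hd with ⟨hdN, hdF⟩ | hdF <;> rcases mem_switch.1 hd' with ⟨hdN', hdF'⟩ | hdF'
  · exact hN v d hdN d' hdN' hv hv'
  · exact absurd hv (hdF v (mem_covered.2 ⟨d', hdF', hv'⟩))
  · exact absurd hv' (hdF' v (mem_covered.2 ⟨d, hdF, hv⟩))
  · exact hF v d hdF d' hdF' hv hv'

theorem at_switch_of_notMem_covered (hN : G.IsMatching N) (hF : G.IsMatching F)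
    (hv : v ∉ G.covered F) (hmate : ∀ d ∈ N, ∀ w, G.Joins d v w → w ∉ G.covered F) :
    G.at_ (G.switch N F) v = G.at_ N v := by
  cases hNv : G.at_ N v with
  | none =>
    rw [at_eq_none_iff, mem_covered] at hNv ⊢
    rintro ⟨e, he, hve⟩
    rcases mem_switch.1 he with ⟨heN, -⟩ | heF
    · exact hNv ⟨e, heN, hve⟩
    · exact hv (mem_covered.2 ⟨e, heF, hve⟩)
  | some d =>
    obtain ⟨hd, hvd⟩ := mem_of_at_eq_some hNv
    obtain ⟨w, hvw⟩ := hvd.exists_joins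
    refine (hN.switch hF).at_eq_some (mem_switch.2 (Or.inl ⟨hd, fun x hx hxd => ?_⟩)) hvd
    rcases hvw.inc_iff.1 hxd with rfl | rfl
    · exact hv hx
    · exact hmate d hd x hvw hx

end IsMatching

end Switch

end BipGraph

namespace Copy

/-- The reversal of the order `a, b, c, x, y, z` of the types. -/
def rev : Copy → Copy
  | a => z
  | b => y
  | c => x
  | x => c
  | y => b
  | z => a

theorem rev_rev (k : Copy) : k.rev.rev = k := by
  cases k <;> rfl

/-- The rules of the two sides agree after reversing the types on one side: a copy whose type looks
like `k` to the agent `v` has the type `view v k`, and vice versa. -/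
def view {U W : Type*} : U ⊕ W → Copy → Copy
  | Sum.inl _, k => k
  | Sum.inr _, k => k.rev

theorem view_view {U W : Type*} (v : U ⊕ W) (k : Copy) : view v (view v k) = k := by
  cases v
  · rfl
  · exact k.rev_rev

/-- The level of a type in the rule `a ⪰^γ b ≻ c ≻ x ⪰^γ y ≻ z`, where `⪰^γ` does not separate
levels. -/
def tier : Copy → ℕ
  | a | b => 0
  | c => 1
  | x | y => 2
  | z => 3

/-- The types on the right of a `⪰^γ`, which have to win by the threshold. -/
def lowered : Copy → Bool
  | b | y => true
  | a | c | x | z => false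

theorem eq_of_tier_eq {k j : Copy} (ht : k.tier = j.tier) (hl : k.lowered = j.lowered) :
    k = j := by
  revert k j
  decide

/-- The three better types. -/
def IsUpper (k : Copy) : Prop := k.tier ≤ 1

instance : DecidablePred IsUpper := fun k => Nat.decLe k.tier 1

theorem isUpper_rev_iff {k : Copy} : k.rev.IsUpper ↔ ¬ k.IsUpper := by
  cases k <;> simp [rev, IsUpper, tier]

theorem tier_eq_of_tier_le {k j : Copy} (hj : j.lowered) (ht : k.tier ≤ j.tier)
    (hk : k.IsUpper → j.IsUpper) : k.tier = j.tier := by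
  revert k j
  decide

theorem eq_b_of_tier_rev_le {k : Copy} (ht : k.tier = 0) (hrev : k.rev.tier ≤ 2) : k = b := by
  revert k
  decide

end Copy

theorem BipGraph.Joins.view_eq {U W E : Type*} {G : BipGraph U W E} {e : E} {v w : U ⊕ W}
    (h : G.Joins e v w) (k : Copy) : Copy.view w k = Copy.view v k.rev := by
  obtain ⟨s, rfl, rfl⟩ := h
  cases s
  · exact k.rev_rev.symm
  · rfl

namespace Market

open BipGraph

variable {U W E : Type*} {I : Market U W E} {γ : U ⊕ W → E → ℝ} {M N F : Finset E}
  {v v' w w' u u' : U ⊕ W} {d d' e f g : E}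

/-! ### Votes and thresholds -/

/-- The edge `e` reaches the threshold of `v` above the outcome `o`. -/
def Improves (I : Market U W E) (γ : U ⊕ W → E → ℝ) (v : U ⊕ W) (o : Option E) (e : E) : Prop :=
  I.p v o + γ v e ≤ I.p v (some e)

theorem voteGamma_of_at_eq (h : I.at_ M v = I.at_ N v) : I.voteGamma γ M N v = 0 :=
  if_pos h

theorem voteGamma_of_improves (hN : I.at_ N v = some e) (h : I.at_ M v ≠ some e)
    (himp : I.Improves γ v (I.at_ M v) e) : I.voteGamma γ M N v = -1 := by
  rw [voteGamma, if_neg (hN ▸ h)]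
  simp only [hN]
  exact if_pos himp

theorem voteGamma_of_not_improves (h : I.at_ M v ≠ I.at_ N v)
    (himp : ∀ e, I.at_ N v = some e → ¬ I.Improves γ v (I.at_ M v) e) :
    I.voteGamma γ M N v = 1 := by
  rw [voteGamma, if_neg h]
  split
  · rfl
  · next e he => exact if_neg (himp e he)

theorem voteGamma_le_one (v : U ⊕ W) : I.voteGamma γ M N v ≤ 1 := by
  unfold voteGamma
  split_ifs
  · exact zero_le_one
  · split
    · exact le_rfl
    · split_ifs <;> decide

theorem neg_one_le_voteGamma (v : U ⊕ W) : -1 ≤ I.voteGamma γ M N v := by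
  unfold voteGamma
  split_ifs
  · decide
  · split
    · decide
    · split_ifs <;> decide

theorem voteWeak_le_one (v : U ⊕ W) : I.voteWeak M N v ≤ 1 := by
  unfold voteWeak
  split_ifs <;> decide

theorem neg_one_le_voteWeak (v : U ⊕ W) : -1 ≤ I.voteWeak M N v := by
  unfold voteWeak
  split_ifs <;> decide

theorem voteWeak_le_voteGamma (hγ : ∀ e, I.Inc v e → 0 < γ v e) :
    I.voteWeak M N v ≤ I.voteGamma γ M N v := by
  by_cases h : I.at_ M v = I.at_ N v
  · rw [voteWeak, if_pos h, voteGamma_of_at_eq h]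
  by_cases himp : ∃ e, I.at_ N v = some e ∧ I.Improves γ v (I.at_ M v) e
  · obtain ⟨e, he, himp⟩ := himp
    rw [voteWeak, if_neg h, if_pos]
    · exact neg_one_le_voteGamma v
    · rw [he]
      exact (lt_add_of_pos_right _ (hγ e (mem_of_at_eq_some he).2)).trans_le himp
  · push Not at himp
    rw [voteGamma_of_not_improves h himp]
    exact voteWeak_le_one v

theorem voteGamma_le_voteWeak (hsmall : I.IsSmall γ) (v : U ⊕ W) :
    I.voteGamma γ M N v ≤ I.voteWeak M N v := by
  by_cases h : I.at_ M v = I.at_ N v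
  · rw [voteWeak, if_pos h, voteGamma_of_at_eq h]
  by_cases hlt : I.p v (I.at_ M v) < I.p v (I.at_ N v)
  · cases hNv : I.at_ N v with
    | none =>
      obtain ⟨f, hf⟩ := Option.ne_none_iff_exists'.1 (hNv ▸ h)
      rw [hf, hNv] at hlt
      exact absurd hlt
        ((I.p_none_nonpos v).trans (I.p_nonneg v f (mem_of_at_eq_some hf).2)).not_gt
    | some e =>
      rw [hNv] at h hlt
      have himp : I.Improves γ v (I.at_ M v) e := hsmall v e (mem_of_at_eq_some hNv).2 _
        (fun f hf => (mem_of_at_eq_some hf).2) hlt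
      rw [voteGamma_of_improves hNv h himp]
      exact neg_one_le_voteWeak v
  · rw [voteWeak, if_neg h, if_neg hlt]
    exact voteGamma_le_one v

theorem IsWeaklyPopular.isGammaPopular [Fintype U] [Fintype W]
    (hγ : ∀ v e, I.Inc v e → 0 < γ v e) (h : I.IsWeaklyPopular N) : I.IsGammaPopular γ N :=
  ⟨h.1, fun M hM => (h.2 M hM).trans
    (Finset.sum_le_sum fun v _ => voteWeak_le_voteGamma (hγ v))⟩

theorem IsGammaPopular.isWeaklyPopular [Fintype U] [Fintype W] (hsmall : I.IsSmall γ)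
    (h : I.IsGammaPopular γ N) : I.IsWeaklyPopular N :=
  ⟨h.1, fun M hM => (h.2 M hM).trans
    (Finset.sum_le_sum fun v _ => voteGamma_le_voteWeak hsmall v)⟩

theorem IsWeaklyStable.isGammaMinStable (hγ : ∀ v e, I.Inc v e → 0 < γ v e)
    (h : I.IsWeaklyStable N) : I.IsGammaMinStable γ N :=
  ⟨h.1, fun ⟨e, he, hblock⟩ => h.2 ⟨e, he, fun v hv =>
    (lt_add_of_pos_right _ (hγ v e hv)).trans_le (hblock v hv)⟩⟩

open Filter Topology in
theorem exists_isSmall [Finite E] (I : Market U W E) :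
    ∃ γ : U ⊕ W → E → ℝ, (∀ v e, 0 < γ v e) ∧ I.IsSmall γ := by
  have small (v : U ⊕ W) (e : E) : ∀ᶠ ε in 𝓝[>] (0 : ℝ), ∀ o : Option E,
      I.p v o < I.p v (some e) → I.p v o + ε ≤ I.p v (some e) := by
    refine eventually_all.2 fun o => eventually_imp_distrib_left.2 fun hlt => ?_
    filter_upwards [nhdsWithin_le_nhds (Iio_mem_nhds (sub_pos.2 hlt))] with ε hε
    exact (lt_sub_iff_add_lt'.1 hε).le
  choose γ hγ hpos using fun v e => ((small v e).and self_mem_nhdsWithin).exists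
  exact ⟨γ, hpos, fun v e _ o _ => hγ v e o⟩

/-! ### Exchange arguments for popular matchings -/

theorem IsGammaPopular.two_mul_card_le [Fintype U] [Fintype W] {T : Finset (U ⊕ W)}
    (hN : I.IsGammaPopular γ N) (hF : I.IsMatching F)
    (himp : ∀ f ∈ F, f ∉ N ∧ ∀ v, I.Inc v f → I.Improves γ v (I.at_ N v) f)
    (hT : ∀ d ∈ N, ∀ v w, I.Joins d v w → w ∈ I.covered F → v ∈ I.covered F ∨ v ∈ T) :
    2 * F.card ≤ T.card := by
  classical
  have vote_le (v : U ⊕ W) : I.voteGamma γ N (I.switch N F) v ≤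
      (if v ∈ T then 1 else 0) - (if v ∈ I.covered F then 1 else 0) := by
    by_cases hv : v ∈ I.covered F
    · obtain ⟨f, hf, hvf⟩ := mem_covered.1 hv
      have hat := (hN.1.switch hF).at_eq_some (mem_switch.2 (Or.inr hf)) hvf
      rw [voteGamma_of_improves hat (fun h => (himp f hf).1 (mem_of_at_eq_some h).1)
        ((himp f hf).2 v hvf), if_pos hv]
      split_ifs <;> decide
    · by_cases hvT : v ∈ T
      · simpa [hv, hvT] using voteGamma_le_one v
      · have hat := hN.1.at_switch_of_notMem_covered hF hv
          fun d hd w hvw hw => (hT d hd v w hvw hw).elim hv hvT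
        simp [hv, hvT, voteGamma_of_at_eq hat.symm]
  have card_covered : (I.covered F).card = 2 * F.card := by
    rw [Finset.card_eq_sum_ones, hF.sum_covered_eq_card_nsmul fun _ _ _ _ _ => one_add_one_eq_two,
      smul_eq_mul, mul_comm]
  have hsum := (hN.2 _ (hN.1.switch hF)).trans (Finset.sum_le_sum fun v _ => vote_le v)
  rw [Finset.sum_sub_distrib, Finset.sum_boole, Finset.sum_boole, Finset.filter_univ_mem,
    Finset.filter_univ_mem, card_covered] at hsum
  exact_mod_cast sub_nonneg.1 hsum

/-- The path `u, d, v', f, v, e, w, g, w', d', u'` alternates between `N` and `M`; exchanging it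
wins four votes and loses at most those of `u` and `u'`. -/
theorem IsGammaPopular.not_exchange [Fintype U] [Fintype W] (hN : I.IsGammaPopular γ N)
    (hM : I.IsMatching M) (he : e ∈ N) (heM : e ∉ M) (hevw : I.Joins e v w)
    (hf : f ∈ M) (hfv : I.Joins f v v') (hd : d ∈ N) (hdv : I.Joins d v' u)
    (hg : g ∈ M) (hgw : I.Joins g w w') (hd' : d' ∈ N) (hdw : I.Joins d' w' u')
    (hu : u ∉ I.covered M) (hv : I.Improves γ v (some e) f) (hv' : I.Improves γ v' (some d) f)
    (hw : I.Improves γ w (some e) g) : ¬ I.Improves γ w' (some d') g := by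
  classical
  intro hw'
  have hfN : f ∉ N := fun h => heM (hN.1 v f h e he hfv.inc_left hevw.inc_left ▸ hf)
  have hgN : g ∉ N := fun h => heM (hN.1 w g h e he hgw.inc_left hevw.inc_right ▸ hg)
  have hfg : f ≠ g := by
    rintro rfl
    obtain rfl : w = v' := (hfv.inc_iff.1 hgw.inc_left).resolve_left hevw.ne.symm
    obtain rfl : d = e := hN.1 w d hd e he hdv.inc_left hevw.inc_right
    obtain rfl : u = v := hdv.right_unique hevw.symm
    exact hu (mem_covered.2 ⟨f, hf, hfv.inc_left⟩)
  have mem_covered_iff (x : U ⊕ W) : x ∈ I.covered {f, g} ↔ I.Inc x f ∨ I.Inc x g := by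
    simp [mem_covered]
  have hcard := hN.two_mul_card_le (F := {f, g}) (T := {u, u'})
    (hM.mono (Finset.insert_subset hf (Finset.singleton_subset_iff.2 hg))) ?_ ?_
  · rw [Finset.card_pair hfg] at hcard
    exact absurd (hcard.trans Finset.card_le_two) (by decide)
  · simp only [Finset.mem_insert, Finset.mem_singleton]
    rintro h (rfl | rfl)
    · refine ⟨hfN, fun x hx => ?_⟩
      rcases hfv.inc_iff.1 hx with rfl | rfl
      · rwa [hN.1.at_eq_some he hevw.inc_left]
      · rwa [hN.1.at_eq_some hd hdv.inc_left]
    · refine ⟨hgN, fun x hx => ?_⟩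
      rcases hgw.inc_iff.1 hx with rfl | rfl
      · rwa [hN.1.at_eq_some he hevw.inc_right]
      · rwa [hN.1.at_eq_some hd' hdw.inc_left]
  · intro c hc x y hxy hy
    have partner {c' : E} {x' : U ⊕ W} (hc' : c' ∈ N) (h : I.Joins c' y x') : x = x' := by
      obtain rfl := hN.1 y c hc c' hc' hxy.inc_right h.inc_left
      exact hxy.symm.right_unique h
    rw [mem_covered_iff, hfv.inc_iff, hgw.inc_iff] at hy ⊢
    rcases hy with (rfl | rfl) | rfl | rfl
    · simp [partner he hevw]
    · simp [partner hd hdv]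
    · simp [partner he hevw.symm]
    · simp [partner hd' hdw]

/-! ### Certificates -/

/-- The properties of a matching `M` on which all guarantees rest: `P` is the set of the endpoints
of the edges of `M` that rank the type of their copy among the three better ones. -/
structure IsCertificate (I : Market U W E) (γ : U ⊕ W → E → ℝ) (M : Finset E)
    (P : Set (U ⊕ W)) : Prop extends I.toBipGraph.IsTransversal M P where
  isMatching : I.IsMatching M
  mem_of_exposed : ∀ ⦃e v w⦄, I.Joins e v w → v ∉ I.covered M → w ∈ P
  not_improves : ∀ ⦃e⦄, e ∉ M → ∀ ⦃v w⦄, I.Joins e v w → v ∉ P → w ∉ P →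
    ¬ I.Improves γ v (I.at_ M v) e
  not_both_improve : ∀ ⦃e⦄, e ∉ M → ∀ ⦃v w⦄, I.Joins e v w → w ∉ P →
    I.Improves γ v (I.at_ M v) e → ¬ I.Improves γ w (I.at_ M w) e
  improves_of_exposed : ∀ ⦃e⦄, e ∉ M → ∀ ⦃v w⦄, I.Joins e v w → w ∉ P →
    ∀ ⦃f⦄, f ∈ M → ∀ ⦃v'⦄, I.Joins f v v' → ∀ ⦃d u⦄, I.Joins d v' u → u ∉ I.covered M →
    I.Improves γ v (some e) f ∧ I.Improves γ v' (some d) f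

namespace IsCertificate

variable {P : Set (U ⊕ W)}

theorem mem_of_nextToExposed (h : I.IsCertificate γ M P) (v : U ⊕ W)
    (hv : I.NextToExposed M N v) : v ∈ P := by
  obtain ⟨e, -, u, hu, hvu⟩ := hv
  exact h.mem_of_exposed hvu.symm hu

open Classical in
/-- The dual solution which shows that `M` is popular. -/
noncomputable def dual (I : Market U W E) (M : Finset E) (P : Set (U ⊕ W)) (v : U ⊕ W) : ℤ :=
  if v ∈ P then 1 else if v ∈ I.covered M then -1 else 0

theorem neg_one_le_dual (v : U ⊕ W) : -1 ≤ dual I M P v := by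
  unfold dual
  split_ifs <;> decide

theorem dual_add_dual (h : I.IsCertificate γ M P) (he : e ∈ M) (hej : I.Joins e v w) :
    dual I M P v + dual I M P w = 0 := by
  have hvM : v ∈ I.covered M := mem_covered.2 ⟨e, he, hej.inc_left⟩
  have hwM : w ∈ I.covered M := mem_covered.2 ⟨e, he, hej.inc_right⟩
  by_cases hv : v ∈ P <;> simp [dual, h.mem_iff_notMem he hej.symm, hvM, hwM, hv]

theorem sum_dual [Fintype U] [Fintype W] (h : I.IsCertificate γ M P) :
    ∑ v, dual I M P v = 0 := by
  have dual_eq_zero (v : U ⊕ W) (hv : v ∉ I.covered M) : dual I M P v = 0 := by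
    rw [dual, if_neg fun hvP => hv (h.subset_covered hvP), if_neg hv]
  rw [← Finset.sum_subset (Finset.subset_univ _) fun v _ hv => dual_eq_zero v hv,
    h.isMatching.sum_covered_eq_card_nsmul fun e he v w => h.dual_add_dual he, smul_zero]

theorem vote_add_dual_nonneg_of_notMem_covered (h : I.IsCertificate γ M P)
    (hv : v ∉ I.covered N) : 0 ≤ I.voteGamma γ M N v + dual I M P v := by
  rw [← at_eq_none_iff] at hv
  by_cases hvM : v ∈ I.covered M
  · rw [voteGamma_of_not_improves (by rwa [hv, ne_eq, at_eq_none_iff, not_not]) (by simp [hv])]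
    linarith [neg_one_le_dual (I := I) (M := M) (P := P) v]
  · rw [voteGamma_of_at_eq ((at_eq_none_iff.2 hvM).trans hv.symm), dual,
      if_neg fun hvP => hvM (h.subset_covered hvP), if_neg hvM, zero_add]

theorem vote_add_dual_nonneg_of_mem (h : I.IsCertificate γ M P) (hN : I.IsMatching N)
    (he : e ∈ N) (hej : I.Joins e v w) :
    0 ≤ (I.voteGamma γ M N v + dual I M P v) + (I.voteGamma γ M N w + dual I M P w) := by
  have hvN := hN.at_eq_some he hej.inc_left
  have hwN := hN.at_eq_some he hej.inc_right
  by_cases heM : e ∈ M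
  · rw [voteGamma_of_at_eq ((h.isMatching.at_eq_some heM hej.inc_left).trans hvN.symm),
      voteGamma_of_at_eq ((h.isMatching.at_eq_some heM hej.inc_right).trans hwN.symm),
      zero_add, zero_add, h.dual_add_dual heM hej]
  have at_ne {x : U ⊕ W} : I.at_ M x ≠ some e := fun hx => heM (mem_of_at_eq_some hx).1
  have vote_eq_one {x : U ⊕ W} (hx : I.at_ N x = some e) (himp : ¬ I.Improves γ x (I.at_ M x) e) :
      I.voteGamma γ M N x = 1 :=
    voteGamma_of_not_improves (hx ▸ at_ne) fun f hf => Option.some.inj (hx.symm.trans hf) ▸ himp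
  have mem_or_mem (himp : I.Improves γ v (I.at_ M v) e ∨ I.Improves γ w (I.at_ M w) e) :
      v ∈ P ∨ w ∈ P := by
    by_contra! hnot
    exact himp.elim (h.not_improves heM hej hnot.1 hnot.2)
      (h.not_improves heM hej.symm hnot.2 hnot.1)
  have dual_eq_one {x : U ⊕ W} (hx : x ∈ P) : dual I M P x = 1 := if_pos hx
  have dual_le := neg_one_le_dual (I := I) (M := M) (P := P)
  have vote_le := neg_one_le_voteGamma (I := I) (γ := γ) (M := M) (N := N)
  by_cases hv : I.Improves γ v (I.at_ M v) e <;> by_cases hw : I.Improves γ w (I.at_ M w) e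
  · have hvP : v ∈ P := not_not.1 fun hvP => h.not_both_improve heM hej.symm hvP hw hv
    have hwP : w ∈ P := not_not.1 fun hwP => h.not_both_improve heM hej hwP hv hw
    linarith [dual_eq_one hvP, dual_eq_one hwP, vote_le v, vote_le w]
  · rcases mem_or_mem (Or.inl hv) with hP | hP <;>
      linarith [vote_eq_one hwN hw, vote_le v, dual_eq_one hP, dual_le v, dual_le w]
  · rcases mem_or_mem (Or.inr hw) with hP | hP <;>
      linarith [vote_eq_one hvN hv, vote_le w, dual_eq_one hP, dual_le v, dual_le w]
  · linarith [vote_eq_one hvN hv, vote_eq_one hwN hw, dual_le v, dual_le w]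

theorem isGammaPopular [Fintype U] [Fintype W] (h : I.IsCertificate γ M P) :
    I.IsGammaPopular γ M := by
  classical
  refine ⟨h.isMatching, fun N hN => ?_⟩
  calc 0 ≤ ∑ e ∈ N, ∑ s, (I.voteGamma γ M N (I.endpt s e) + dual I M P (I.endpt s e)) :=
        Finset.sum_nonneg fun e he =>
          (h.vote_add_dual_nonneg_of_mem hN he (joins_endpt (s := true))).trans_eq
            ((joins_endpt.sum_endpt fun v => I.voteGamma γ M N v + dual I M P v).symm)
    _ = ∑ v ∈ I.covered N, (I.voteGamma γ M N v + dual I M P v) :=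
        (hN.sum_covered fun v => I.voteGamma γ M N v + dual I M P v).symm
    _ ≤ ∑ v, (I.voteGamma γ M N v + dual I M P v) :=
        Finset.sum_le_sum_of_subset_of_nonneg (Finset.subset_univ _) fun v _ hv =>
          h.vote_add_dual_nonneg_of_notMem_covered hv
    _ = ∑ v, I.voteGamma γ M N v := by rw [Finset.sum_add_distrib, h.sum_dual, add_zero]

theorem two_thirds_mul_card_le (h : I.IsCertificate γ M P) (hN : I.IsMatching N) :
    (2 / 3 : ℝ) * N.card ≤ M.card :=
  h.toIsTransversal.two_thirds_mul_card_le h.isMatching hN h.mem_of_nextToExposed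

theorem three_quarters_mul_card_le [Fintype U] [Fintype W] (h : I.IsCertificate γ M P)
    (hN : I.IsGammaPopular γ N) : (3 / 4 : ℝ) * N.card ≤ M.card := by
  refine h.toIsTransversal.three_quarters_mul_card_le h.isMatching hN.1 h.mem_of_nextToExposed ?_
  intro e he heM v w hvw hvmate hwmate
  have hvP := h.notMem_of_mateNextToExposed h.mem_of_nextToExposed hvmate
  have hwP := h.notMem_of_mateNextToExposed h.mem_of_nextToExposed hwmate
  obtain ⟨f, hf, v', hfv, d, hd, u, hu, hdv⟩ := hvmate
  obtain ⟨g, hg, w', hgw, d', hd', u', hu', hdw⟩ := hwmate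
  obtain ⟨hv, hv'⟩ := h.improves_of_exposed heM hvw hwP hf hfv hdv hu
  obtain ⟨hw, hw'⟩ := h.improves_of_exposed heM hvw.symm hvP hg hgw hdw hu'
  exact hN.not_exchange h.isMatching he heM hvw hf hfv hd hdv hg hgw hd' hdw hu hv hv' hw hw'

theorem four_fifths_mul_card_le (h : I.IsCertificate γ M P) (hN : I.IsGammaMinStable γ N) :
    (4 / 5 : ℝ) * N.card ≤ M.card := by
  refine h.toIsTransversal.four_fifths_mul_card_le h.isMatching hN.1 h.mem_of_nextToExposed ?_
  rintro e he heM v w hvw ⟨f, hf, v', hfv, d, hd, u, hu, hdv⟩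
  by_contra hwP
  obtain ⟨hv, hv'⟩ := h.improves_of_exposed heM hvw hwP hf hfv hdv hu
  have hfN : f ∉ N := fun hfN => heM (hN.1 v f hfN e he hfv.inc_left hvw.inc_left ▸ hf)
  refine hN.2 ⟨f, hfN, fun x hx => ?_⟩
  rcases hfv.inc_iff.1 hx with rfl | rfl
  · rwa [hN.1.at_eq_some he hvw.inc_left]
  · rwa [hN.1.at_eq_some hd hdv.inc_left]

end IsCertificate

/-! ### Preferences on the copies -/

section Copies

variable {pref : U ⊕ W → Copy × E → Copy × E → Prop} {k j : Copy}

theorem endpt_copies (s : Bool) (c : Copy × E) : I.copies.endpt s c = I.endpt s c.2 := by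
  cases s <;> rfl

theorem inc_copies {c : Copy × E} : I.copies.Inc v c ↔ I.Inc v c.2 := by
  simp only [Inc, endpt_copies]

/-- The preferences with the types as they look to each agent, so that both sides follow the same
rule. -/
def normalize (pref : U ⊕ W → Copy × E → Copy × E → Prop) (v : U ⊕ W) (c c' : Copy × E) : Prop :=
  pref v (Copy.view v c.1, c.2) (Copy.view v c'.1, c'.2)

theorem isStrictPref_normalize (h : I.copies.IsStrictPref pref) :
    I.copies.IsStrictPref (normalize pref) := by
  have inc_view {v : U ⊕ W} {c : Copy × E} (hc : I.copies.Inc v c) :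
      I.copies.Inc v (Copy.view v c.1, c.2) := by
    rwa [inc_copies] at hc ⊢
  refine ⟨fun v c hc => h.irrefl v _ (inc_view hc), fun v c c' c'' hc hc' hc'' =>
    h.trans v _ _ _ (inc_view hc) (inc_view hc') (inc_view hc''), fun v c c' hc hc' hne =>
    h.total v _ _ (inc_view hc) (inc_view hc') fun heq => hne ?_⟩
  have hview := (Prod.ext_iff.1 heq).1
  exact Prod.ext (by simpa only [Copy.view_view] using congrArg (Copy.view v) hview)
    (Prod.ext_iff.1 heq).2

theorem IsInduced.followsRule_normalize (h : I.IsInduced γ pref) (v : U ⊕ W) :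
    I.FollowsRule γ (normalize pref) v .a .b .c .x .y .z := by
  cases v with
  | inl u => exact h.left u
  | inr w => exact h.right w

theorem isInduced_normalize (hs : I.copies.IsStrictPref pref)
    (h : ∀ v, I.FollowsRule γ pref v .a .b .c .x .y .z) : I.IsInduced γ (normalize pref) where
  strict := isStrictPref_normalize hs
  left u := h (Sum.inl u)
  right w := h (Sum.inr w)

namespace FollowsRule

theorem above_of_tier_lt (h : I.FollowsRule γ pref v .a .b .c .x .y .z)
    (hs : I.copies.IsStrictPref pref) (ht : k.tier < j.tier) : I.Above pref v k j := by
  obtain ⟨⟨hab, -⟩, hbc, hcx, ⟨hxy, -⟩, hyz, -⟩ := h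
  have trans {α β δ : Copy} {e f g : E} (he : I.Inc v e) (hf : I.Inc v f) (hg : I.Inc v g) :
      pref v (α, e) (β, f) → pref v (β, f) (δ, g) → pref v (α, e) (δ, g) :=
    hs.trans v _ _ _ (inc_copies.2 he) (inc_copies.2 hf) (inc_copies.2 hg)
  have above_trans {α β δ : Copy} (hαβ : I.Above pref v α β) (hβδ : I.Above pref v β δ) :
      I.Above pref v α δ :=
    fun e f he hf => trans he he hf (hαβ e e he he) (hβδ e f he hf)
  have above_left {α β δ : Copy} (hαβ : ∀ e, I.Inc v e → pref v (α, e) (β, e))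
      (hβδ : I.Above pref v β δ) : I.Above pref v α δ :=
    fun e f he hf => trans he he hf (hαβ e he) (hβδ e f he hf)
  have hcy : I.Above pref v .c .y :=
    fun e f he hf => trans he hf hf (hcx e f he hf) (hxy f hf)
  have hcz := above_trans hcy hyz
  have hbx := above_trans hbc hcx
  have hby := above_trans hbc hcy
  have hbz := above_trans hbc hcz
  have hac := above_left hab hbc
  have hax := above_left hab hbx
  have hay := above_left hab hby
  have haz := above_left hab hbz
  have hxz := above_left hxy hyz
  cases k <;> cases j <;> first | assumption | exact absurd ht (by decide)

theorem tier_le_of_pref (h : I.FollowsRule γ pref v .a .b .c .x .y .z)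
    (hs : I.copies.IsStrictPref pref) (hf : I.Inc v f) (he : I.Inc v e)
    (hp : pref v (k, f) (j, e)) : k.tier ≤ j.tier := by
  by_contra! ht
  exact hs.asymm (inc_copies.2 hf) (inc_copies.2 he) hp (h.above_of_tier_lt hs ht e f he hf)

theorem not_improves (h : I.FollowsRule γ pref v .a .b .c .x .y .z)
    (hs : I.copies.IsStrictPref pref) (hf : I.Inc v f) (he : I.Inc v e)
    (hj : j.lowered) (ht : k.tier = j.tier) (hp : pref v (k, f) (j, e)) :
    ¬ I.Improves γ v (some f) e := by
  have of_gammaAbove {α : Copy} (hα : I.GammaAbove γ pref v α j) (hk : k = α ∨ k = j) :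
      ¬ I.Improves γ v (some f) e := by
    intro himp
    have hα' : pref v (j, e) (α, f) := (hα.2 f e hf he).2 himp
    refine hs.asymm (v := v) (inc_copies.2 he) (inc_copies.2 hf) hα' ?_
    rcases hk with rfl | rfl
    · exact hp
    · exact hs.trans v _ _ _ (inc_copies.2 hf) (inc_copies.2 hf) (inc_copies.2 he) (hα.1 f hf) hp
  obtain ⟨hab, -, -, hxy, -⟩ := h
  cases j <;> first
    | exact absurd hj (by decide)
    | exact of_gammaAbove ‹_› (by revert ht; cases k <;> decide)

theorem improves (h : I.FollowsRule γ pref v .a .b .c .x .y .z) (hf : I.Inc v f) (he : I.Inc v e)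
    (hk : k.lowered) (hj : ¬ j.lowered) (ht : k.tier = j.tier) (hp : pref v (k, f) (j, e)) :
    I.Improves γ v (some e) f := by
  obtain ⟨⟨-, hab⟩, -, -, ⟨-, hxy⟩, -⟩ := h
  cases k <;> cases j <;> first
    | exact (hab e f he hf).1 hp
    | exact (hxy e f he hf).1 hp
    | exact absurd hk (by decide)
    | exact absurd ht (by decide)
    | exact absurd rfl hj

end FollowsRule

/-! ### Existence of the preferences -/

/-- Sorting by this key, smallest first, gives preferences that follow the rules; the comparison of
types within a level comes after that of the valuations since the threshold has only to be
reached. -/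
noncomputable def sortKey [LinearOrder E] (I : Market U W E) (γ : U ⊕ W → E → ℝ) (v : U ⊕ W)
    (c : Copy × E) : ℕ ×ₗ ℝ ×ₗ Bool ×ₗ E :=
  toLex (c.1.tier, toLex ((if c.1.lowered then γ v c.2 else 0) - I.p v (some c.2),
    toLex (!c.1.lowered, c.2)))

theorem sortKey_injective [LinearOrder E] (v : U ⊕ W) : Function.Injective (I.sortKey γ v) := by
  rintro ⟨k, e⟩ ⟨j, f⟩ h
  simp only [sortKey, EmbeddingLike.apply_eq_iff_eq, Prod.mk.injEq, Bool.not_inj_iff] at h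
  obtain ⟨ht, -, hl, rfl⟩ := h
  rw [Copy.eq_of_tier_eq ht hl]

theorem followsRule_sortKey [LinearOrder E] (hγ : ∀ e, I.Inc v e → 0 < γ v e) :
    I.FollowsRule γ (fun v c c' => I.sortKey γ v c < I.sortKey γ v c') v .a .b .c .x .y .z := by
  have above {α β : Copy} (ht : α.tier < β.tier) :
      I.Above (fun v c c' => I.sortKey γ v c < I.sortKey γ v c') v α β :=
    fun _ _ _ _ => Prod.Lex.toLex_lt_toLex.2 (Or.inl ht)
  have sorted {α : Copy} (hα : α.lowered = false) :
      I.Sorted (fun v c c' => I.sortKey γ v c < I.sortKey γ v c') v α := by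
    intro e f _ _ h
    simp [sortKey, Prod.Lex.toLex_lt_toLex, hα, h]
  have gammaAbove {α β : Copy} (ht : α.tier = β.tier) (hα : α.lowered = false)
      (hβ : β.lowered = true) :
      I.GammaAbove γ (fun v c c' => I.sortKey γ v c < I.sortKey γ v c') v α β := by
    refine ⟨fun e he => ?_, fun e f _ _ => ?_⟩
    · simp [sortKey, Prod.Lex.toLex_lt_toLex, ht, hα, hβ, hγ e he]
    · simp [sortKey, Prod.Lex.toLex_lt_toLex, ht, hα, hβ, ← le_iff_lt_or_eq]
  exact ⟨gammaAbove rfl rfl rfl, above (by decide), above (by decide), gammaAbove rfl rfl rfl,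
    above (by decide), sorted rfl, sorted rfl, sorted rfl, sorted rfl⟩

theorem exists_isInduced (hγ : ∀ v e, I.Inc v e → 0 < γ v e) : ∃ pref, I.IsInduced γ pref := by
  classical
  let _ : LinearOrder E := linearOrderOfSTO WellOrderingRel
  exact ⟨_, isInduced_normalize (IsStrictPref.of_injective sortKey_injective)
    fun v => followsRule_sortKey (hγ v)⟩

/-! ### Stable matchings of the copies -/

variable {K : Finset (Copy × E)}

open Classical in
/-- The edges with a copy in `K`. -/
noncomputable def edges (K : Finset (Copy × E)) : Finset E :=
  K.image Prod.snd

/-- In the matching `K` of the copies, `v` is assigned a copy of `f` whose type looks like `k`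
to `v`. -/
def Assigned (I : Market U W E) (K : Finset (Copy × E)) (v : U ⊕ W) (k : Copy) (f : E) : Prop :=
  I.Inc v f ∧ (Copy.view v k, f) ∈ K

/-- The agents that are assigned a copy of one of the three better types. -/
def upper (I : Market U W E) (K : Finset (Copy × E)) : Set (U ⊕ W) :=
  {v | ∃ k f, I.Assigned K v k f ∧ k.IsUpper}

/-- The agent `v` is assigned something better than the copy of `e` whose type looks like `j`
to `v`. -/
def Rejects (I : Market U W E) (pref : U ⊕ W → Copy × E → Copy × E → Prop) (K : Finset (Copy × E))
    (v : U ⊕ W) (j : Copy) (e : E) : Prop :=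
  ∃ k f, I.Assigned K v k f ∧ normalize pref v (k, f) (j, e)

theorem mem_edges : e ∈ edges K ↔ ∃ k, (k, e) ∈ K := by
  simp [edges]

theorem exists_assigned (hf : f ∈ edges K) (hv : I.Inc v f) : ∃ k, I.Assigned K v k f := by
  obtain ⟨k, hk⟩ := mem_edges.1 hf
  exact ⟨Copy.view v k, hv, by rwa [Copy.view_view]⟩

namespace Assigned

theorem mem_edges (h : I.Assigned K v k f) : f ∈ edges K :=
  Market.mem_edges.2 ⟨_, h.2⟩

theorem mem_covered (h : I.Assigned K v k f) : v ∈ I.covered (edges K) :=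
  BipGraph.mem_covered.2 ⟨f, h.mem_edges, h.1⟩

theorem of_joins (h : I.Assigned K v k f) (hf : I.Joins f v w) : I.Assigned K w k.rev f :=
  ⟨hf.inc_right, by rw [hf.view_eq, Copy.rev_rev]; exact h.2⟩

theorem unique (h : I.Assigned K v k f) (hK : I.copies.IsMatching K) (h' : I.Assigned K v j g) :
    k = j ∧ f = g := by
  have heq := Prod.ext_iff.1 (hK v _ h.2 _ h'.2 (inc_copies.2 h.1) (inc_copies.2 h'.1))
  exact ⟨by simpa only [Copy.view_view] using congrArg (Copy.view v) heq.1, heq.2⟩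

theorem mem_upper_iff (h : I.Assigned K v k f) (hK : I.copies.IsMatching K) :
    v ∈ I.upper K ↔ k.IsUpper := by
  refine ⟨?_, fun hk => ⟨k, f, h, hk⟩⟩
  rintro ⟨j, g, h', hj⟩
  exact (h.unique hK h').1 ▸ hj

end Assigned

theorem isMatching_edges (hK : I.copies.IsMatching K) : I.IsMatching (edges K) := by
  intro v e he f hf hve hvf
  obtain ⟨k, hk⟩ := exists_assigned he hve
  obtain ⟨j, hj⟩ := exists_assigned hf hvf
  exact (hk.unique hK hj).2

theorem Assigned.at_edges (h : I.Assigned K v k f) (hK : I.copies.IsMatching K) :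
    I.at_ (edges K) v = some f :=
  (isMatching_edges hK).at_eq_some h.mem_edges h.1

theorem isTransversal_upper (hK : I.copies.IsMatching K) :
    I.IsTransversal (edges K) (I.upper K) where
  subset_covered := fun _ ⟨_, _, h, _⟩ => h.mem_covered
  mem_iff_notMem f hf v w hvw := by
    obtain ⟨k, hk⟩ := exists_assigned hf hvw.inc_left
    rw [hk.mem_upper_iff hK, (hk.of_joins hvw).mem_upper_iff hK, Copy.isUpper_rev_iff, not_not]

theorem pref_of_not_rejects (hs : I.copies.IsStrictPref pref) (he : e ∉ edges K) (hv : I.Inc v e)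
    (hnot : ¬ I.Rejects pref K v j e) {c : Copy × E} (hc : c ∈ K) (hvc : I.Inc v c.2) :
    pref v (Copy.view v j, e) c := by
  have hne : (Copy.view v j, e) ≠ c := by
    rintro rfl
    exact he (mem_edges.2 ⟨_, hc⟩)
  refine (hs.total v _ c (inc_copies.2 hv) (inc_copies.2 hvc) hne).resolve_right fun hp => hnot ?_
  refine ⟨Copy.view v c.1, c.2, ⟨hvc, ?_⟩, ?_⟩
  · rwa [Copy.view_view]
  · rwa [normalize, Copy.view_view]

theorem rejects_or_rejects (hs : I.copies.IsStrictPref pref) (hK : I.copies.IsStable pref K)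
    (he : e ∉ edges K) (hvw : I.Joins e v w) (j : Copy) :
    I.Rejects pref K v j e ∨ I.Rejects pref K w j.rev e := by
  by_contra! hnot
  refine hK.2 ⟨(Copy.view v j, e), fun h => he (mem_edges.2 ⟨_, h⟩), fun x hx c hc hxc => ?_⟩
  rw [inc_copies] at hx hxc
  rcases hvw.inc_iff.1 hx with rfl | rfl
  · exact pref_of_not_rejects hs he hx hnot.1 hc hxc
  · rw [← Copy.rev_rev j, ← hvw.view_eq]
    exact pref_of_not_rejects hs he hx hnot.2 hc hxc

namespace IsInduced

theorem mem_upper_of_rejects (h : I.IsInduced γ pref) (he : I.Inc v e)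
    (hr : I.Rejects pref K v j e) (hj : j.IsUpper) : v ∈ I.upper K := by
  obtain ⟨k, f, hk, hp⟩ := hr
  exact ⟨k, f, hk, ((h.followsRule_normalize v).tier_le_of_pref
    (isStrictPref_normalize h.strict) hk.1 he hp).trans hj⟩

theorem not_improves_of_rejects (h : I.IsInduced γ pref) (hK : I.copies.IsMatching K)
    (he : I.Inc v e) (hr : I.Rejects pref K v j e) (hj : j.lowered)
    (hv : v ∈ I.upper K → j.IsUpper) : ¬ I.Improves γ v (I.at_ (edges K) v) e := by
  obtain ⟨k, f, hk, hp⟩ := hr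
  have hrule := h.followsRule_normalize v
  have hs := isStrictPref_normalize h.strict
  rw [hk.mem_upper_iff hK] at hv
  rw [hk.at_edges hK]
  exact hrule.not_improves hs hk.1 he hj
    (Copy.tier_eq_of_tier_le hj (hrule.tier_le_of_pref hs hk.1 he hp) hv) hp

theorem exists_assigned_of_exposed (h : I.IsInduced γ pref) (hK : I.copies.IsStable pref K)
    (hvw : I.Joins e v w) (hv : v ∉ I.covered (edges K)) :
    ∃ k f, I.Assigned K w k f ∧ k.tier = 0 ∧ (k.lowered → I.Improves γ w (some e) f) := by
  have he : e ∉ edges K := fun he => hv (BipGraph.mem_covered.2 ⟨e, he, hvw.inc_left⟩)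
  have hnot : ¬ I.Rejects pref K v .z e := fun ⟨k, f, hk, _⟩ => hv hk.mem_covered
  obtain ⟨k, f, hk, hp⟩ := (rejects_or_rejects h.strict hK he hvw .z).resolve_left hnot
  have hrule := h.followsRule_normalize w
  have ht : k.tier = 0 := Nat.le_zero.1 <|
    hrule.tier_le_of_pref (isStrictPref_normalize h.strict) hk.1 hvw.inc_right hp
  exact ⟨k, f, hk, ht, fun hl =>
    hrule.improves (j := .a) hk.1 hvw.inc_right hl (by decide) ht hp⟩

theorem improves_of_exposed (h : I.IsInduced γ pref) (hK : I.copies.IsStable pref K)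
    (he : e ∉ edges K) (hvw : I.Joins e v w) (hw : w ∉ I.upper K) (hf : f ∈ edges K)
    (hfv : I.Joins f v v') (hdv : I.Joins d v' u) (hu : u ∉ I.covered (edges K)) :
    I.Improves γ v (some e) f ∧ I.Improves γ v' (some d) f := by
  obtain ⟨k, f', hk, ht, himp⟩ := h.exists_assigned_of_exposed hK hdv.symm hu
  obtain rfl : f' = f := isMatching_edges hK.1 v' f' hk.mem_edges f hf hk.1 hfv.inc_right
  obtain ⟨k', f, hk', hp⟩ := (rejects_or_rejects h.strict hK he hvw .x).resolve_right
    fun hr => hw (h.mem_upper_of_rejects hvw.inc_right hr (by decide))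
  obtain ⟨rfl, rfl⟩ := (hk.of_joins hfv.symm).unique hK.1 hk'
  have hrule := h.followsRule_normalize v
  obtain rfl : k = .b := Copy.eq_b_of_tier_rev_le ht <|
    hrule.tier_le_of_pref (isStrictPref_normalize h.strict) hk'.1 hvw.inc_left hp
  exact ⟨hrule.improves (k := .y) (j := .x) hk'.1 hvw.inc_left rfl (by decide) rfl hp, himp rfl⟩

theorem isCertificate (h : I.IsInduced γ pref) (hK : I.copies.IsStable pref K) :
    I.IsCertificate γ (edges K) (I.upper K) where
  toIsTransversal := isTransversal_upper hK.1
  isMatching := isMatching_edges hK.1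
  mem_of_exposed e v w hvw hv := by
    obtain ⟨k, f, hk, ht, -⟩ := h.exists_assigned_of_exposed hK hvw hv
    exact ⟨k, f, hk, ht.trans_le zero_le_one⟩
  not_improves e he v w hvw hv hw := by
    have hr := (rejects_or_rejects h.strict hK he hvw .y).resolve_right
      fun hr => hw (h.mem_upper_of_rejects hvw.inc_right hr (by decide))
    exact h.not_improves_of_rejects hK.1 hvw.inc_left hr rfl fun hv' => absurd hv' hv
  not_both_improve e he v w hvw hw himp := by
    have hr := (rejects_or_rejects h.strict hK he hvw .b).resolve_left fun hr =>
      h.not_improves_of_rejects hK.1 hvw.inc_left hr rfl (fun _ => by decide) himp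
    exact h.not_improves_of_rejects hK.1 hvw.inc_right hr rfl fun hw' => absurd hw' hw
  improves_of_exposed e he v w hvw hw f hf v' hfv d u hdv hu :=
    h.improves_of_exposed hK he hvw hw hf hfv hdv hu

theorem isCertificate_output [Fintype E] (h : I.IsInduced γ pref) (s : Bool) :
    I.IsCertificate γ (I.output pref s) (I.upper (I.copies.galeShapley pref s)) :=
  h.isCertificate (h.strict.isStable_galeShapley s)

end IsInduced

theorem exists_isGammaPopular [Fintype U] [Fintype W] [Finite E]
    (hγ : ∀ v e, I.Inc v e → 0 < γ v e) : ∃ M, I.IsGammaPopular γ M := by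
  cases nonempty_fintype E
  obtain ⟨pref, h⟩ := exists_isInduced hγ
  exact ⟨_, (h.isCertificate_output true).isGammaPopular⟩

end Copies

end Market

theorem mainTheorem1 {U W E : Type*} [Fintype U] [Fintype W] [Fintype E] (I : Market U W E) :
    (∃ M, I.IsWeaklyPopular M) ∧
    ∀ γ : U ⊕ W → E → ℝ, (∀ v e, I.Inc v e → 0 < γ v e) →
      (∃ M, I.IsGammaPopular γ M) ∧
      (∃ pref, I.IsInduced γ pref) ∧
      ∀ pref, I.IsInduced γ pref → ∀ s : Bool,
        I.copies.IsStable pref (I.copies.galeShapley pref s) ∧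
        I.IsGammaPopular γ (I.output pref s) ∧
        (I.IsSmall γ → I.IsWeaklyPopular (I.output pref s)) ∧
        (∀ N, I.IsMatching N → (2 / 3 : ℝ) * N.card ≤ (I.output pref s).card) ∧
        (∀ N, I.IsGammaPopular γ N → (3 / 4 : ℝ) * N.card ≤ (I.output pref s).card) ∧
        (∀ N, I.IsWeaklyPopular N → (3 / 4 : ℝ) * N.card ≤ (I.output pref s).card) ∧
        (∀ N, I.IsGammaMinStable γ N → (4 / 5 : ℝ) * N.card ≤ (I.output pref s).card) ∧
        (∀ N, I.IsWeaklyStable N → (4 / 5 : ℝ) * N.card ≤ (I.output pref s).card) := by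
  refine ⟨?_, fun γ hγ => ⟨Market.exists_isGammaPopular hγ, Market.exists_isInduced hγ, ?_⟩⟩
  · obtain ⟨γ, hγ, hsmall⟩ := I.exists_isSmall
    obtain ⟨M, hM⟩ := Market.exists_isGammaPopular fun v e _ => hγ v e
    exact ⟨M, hM.isWeaklyPopular hsmall⟩
  · intro pref h s
    have hcert := h.isCertificate_output s
    exact ⟨h.strict.isStable_galeShapley s,
      hcert.isGammaPopular,
      hcert.isGammaPopular.isWeaklyPopular,
      fun _ => hcert.two_thirds_mul_card_le,
      fun _ => hcert.three_quarters_mul_card_le,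
      fun _ hN => hcert.three_quarters_mul_card_le (hN.isGammaPopular hγ),
      fun _ => hcert.four_fifths_mul_card_le,
      fun _ hN => hcert.four_fifths_mul_card_le (hN.isGammaMinStable hγ)⟩
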